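/- All quantum systems $A, D, E, A', D', E'$ are finite-dimensional, $\mathcal{S}(X)$ is the set of density operators on $X$, and $\log$ is the natural logarithm. For $\alpha\in(0,1)\cup(1,\infty)$ and finite nonnegative vectors $P,Q$ put $Q_\alpha(P\|Q):=\sum_x P(x)^\alpha Q(x)^{1-\alpha}$, where for $\alpha>1$ terms with $P(x)=0$ are $0$ and terms with $P(x)>0=Q(x)$ are $+\infty$. For positive semidefinite operators $\rho,\sigma$ and a POVM $M=(M(x))_{x\in\mathcal X}$ on a finite set $\mathcal X$ let $P_{\rho,M}(x):=\mathrm{tr}[M(x)\rho]$, and let $Q^{\mathbb M}_\alpha(\rho\|\sigma)$ be the supremum (if $\alpha>1$), respectively the infimum (if $\alpha<1$), of $Q_\alpha(P_{\rho,M}\|P_{\sigma,M})$ over all finite sets $\mathcal X$ and all POVMs $M$ on $\mathcal X$; thus the measured Rényi relative entropy is $D^{\mathbb M}_\alpha(\rho\|\sigma)=\sup_{(\mathcal X,M)}\frac{1}{\alpha-1}\log Q_\alpha(P_{\rho,M}\|P_{\sigma,M})=\frac1{\alpha-1}\log Q^{\mathbb M}_\alpha(\rho\|\sigma)$. For $\rho_{AD}\in\mathcal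 S(AD)$ and $\sigma_{AE}\in\mathcal S(AE)$ define the measured Rényi relative entropy of recovery $$D^{\mathbb M,\mathrm{rec}}_\alpha(\rho_{AD}\|\sigma_{AE}):=\frac1{\alpha-1}\log Q^{\mathbb M,\mathrm{rec}}_\alpha(\rho_{AD}\|\sigma_{AE}),$$ where $Q^{\mathbb M,\mathrm{rec}}_\alpha(\rho_{AD}\|\sigma_{AE})$ is the infimum (if $\alpha>1$), respectively the supremum (if $\alpha<1$), of $Q^{\mathbb M}_\alpha\big(\rho_{AD}\,\big\|\,(\mathcal I_A\otimes\Gamma_{E\to D})(\sigma_{AE})\big)$ over all trace-preserving completely positive maps $\Gamma_{E\to D}$. **Proposition.** Let $\rho_{AD}\in\mathcal{S}(AD)$, $\tau_{A'D'}\in\mathcal{S}(A'D')$, $\sigma_{AE}\in\mathcal{S}(AE)$ and $\omega_{A'E'}\in\mathcal{S}(A'E')$ with $\sigma_A>0$ and $\omega_{A'}>0$. Then, for every $\alpha\in(0,1)\cup(1,\infty)$, $$D_{\alpha}^{\mathbb{M},\mathrm{rec}}(\rho_{AD}\otimes\tau_{A'D'}\|\sigma_{AE}\otimes\omega_{A'E'})\;\geq\;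 D_{\alpha}^{\mathbb{M},\mathrm{rec}}(\rho_{AD}\|\sigma_{AE})+D_{\alpha}^{\mathbb{M},\mathrm{rec}}(\tau_{A'D'}\|\omega_{A'E'}),$$ where on the left-hand side the recovery maps are all trace-preserving completely positive maps from $EE'$ to $DD'$. -/

import Mathlib

open Matrix
open scoped ComplexOrder Kronecker ENNReal

noncomputable section

/-! Finite-dimensional quantum systems are modelled by finite types: operators on the Hilbert space
`ℂ^A` are the matrices `Matrix A A ℂ`, and the joint system `AB` is the product type `A × B`. -/

/-- Density operators: positive semidefinite matrices of unit trace. -/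
structure IsDensityOperator {A : Type*} [Fintype A] (ρ : Matrix A A ℂ) : Prop where
  posSemidef : ρ.PosSemidef
  trace_eq_one : ρ.trace = 1

/-- The marginal `σ_A = tr_E σ_{AE}`, the partial trace over the second tensor factor. -/
def marginal {A E : Type*} [Fintype E] (σ : Matrix (A × E) (A × E) ℂ) : Matrix A A ℂ :=
  Matrix.of fun a a' => ∑ e, σ (a, e) (a', e)

/-- The tensor product `ρ_{AB} ⊗ τ_{A'B'}`, regarded as an operator on the bipartite system
with first part `AA'` and second part `BB'`. -/
def bipartiteTensor {A B A' B' : Type*} (ρ : Matrix (A × B) (A × B) ℂ)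
    (τ : Matrix (A' × B') (A' × B') ℂ) :
    Matrix ((A × A') × (B × B')) ((A × A') × (B × B')) ℂ :=
  (ρ ⊗ₖ τ).submatrix (Equiv.prodProdProdComm A A' B B') (Equiv.prodProdProdComm A A' B B')

/-- The map `𝓘_R ⊗ Γ`: a matrix on `R × E` is regarded as an `R`-by-`R` block matrix with
blocks in `Matrix E E ℂ`, and `Γ` is applied to every block. -/
def idTensor (R : Type*) {E D : Type*} (Γ : Matrix E E ℂ →ₗ[ℂ] Matrix D D ℂ)
    (X : Matrix (R × E) (R × E) ℂ) : Matrix (R × D) (R × D) ℂ :=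
  Matrix.of fun p q => Γ (Matrix.of fun e e' => X (p.1, e) (q.1, e')) p.2 q.2

/-- Quantum channels: trace-preserving completely positive linear maps. -/
structure QuantumChannel (E D : Type*) [Fintype E] [Fintype D] where
  /-- the underlying linear map -/
  toLinearMap : Matrix E E ℂ →ₗ[ℂ] Matrix D D ℂ
  completelyPositive : ∀ (k : ℕ) (X : Matrix (Fin k × E) (Fin k × E) ℂ),
    X.PosSemidef → (idTensor (Fin k) toLinearMap X).PosSemidef
  tracePreserving : ∀ X : Matrix E E ℂ, (toLinearMap X).trace = X.trace

/-- Positive operator valued measures on the finite set `𝒳`. -/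
structure POVM (𝒳 A : Type*) [Fintype 𝒳] [DecidableEq A] where
  /-- the measurement operators -/
  op : 𝒳 → Matrix A A ℂ
  posSemidef : ∀ x, (op x).PosSemidef
  sum_eq_one : ∑ x, op x = 1

/-- The measurement statistics `P_{ρ,M}(x) = tr[M(x) ρ]`; for positive semidefinite `ρ` this
trace is a nonnegative real number. -/
def POVM.stat {𝒳 A : Type*} [Fintype 𝒳] [Fintype A] [DecidableEq A] (M : POVM 𝒳 A)
    (ρ : Matrix A A ℂ) (x : 𝒳) : ℝ≥0∞ :=
  ENNReal.ofReal (M.op x * ρ).trace.re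

/-- The classical quantity `∑ₓ P(x)^α Q(x)^(1-α)` with values in `[0, ∞]`. For `1 < α` the
conventions `0 ^ (1 - α) = ∞` and `0 * ∞ = 0` in `[0, ∞]` make it infinite exactly when
`P` is not absolutely continuous with respect to `Q`, and drop the terms with `P(x) = 0`. -/
def classicalQ {𝒳 : Type*} [Fintype 𝒳] (α : ℝ) (P Q : 𝒳 → ℝ≥0∞) : ℝ≥0∞ :=
  ∑ x, P x ^ α * Q x ^ (1 - α)

/-- The classical Rényi divergence `D_α(P‖Q)`. Here `log 0 = -∞` and `log ∞ = ∞`. -/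
def classicalRenyi {𝒳 : Type*} [Fintype 𝒳] (α : ℝ) (P Q : 𝒳 → ℝ≥0∞) : EReal :=
  (((α - 1)⁻¹ : ℝ) : EReal) * ENNReal.log (classicalQ α P Q)

/-- The measured Rényi relative entropy `D^𝕄_α(ρ‖σ)`: the supremum of the classical Rényi
divergence over all POVMs on finite sets. -/
def measuredRenyi {A : Type*} [Fintype A] [DecidableEq A] (α : ℝ) (ρ σ : Matrix A A ℂ) : EReal :=
  ⨆ (n : ℕ) (M : POVM (Fin n) A), classicalRenyi α (M.stat ρ) (M.stat σ)

/-- The quantity `Q^𝕄_α(ρ‖σ)` for which `D^𝕄_α(ρ‖σ) = (α - 1)⁻¹ log Q^𝕄_α(ρ‖σ)`: an infimum over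
all POVMs for `α < 1`, a supremum for `1 < α`. -/
def measuredQ {A : Type*} [Fintype A] [DecidableEq A] (α : ℝ) (ρ σ : Matrix A A ℂ) : ℝ≥0∞ :=
  if α < 1 then ⨅ (n : ℕ) (M : POVM (Fin n) A), classicalQ α (M.stat ρ) (M.stat σ)
  else ⨆ (n : ℕ) (M : POVM (Fin n) A), classicalQ α (M.stat ρ) (M.stat σ)

/-- `measuredQ` is the quantity that belongs to the measured Rényi relative entropy. -/
theorem measuredRenyi_eq {A : Type*} [Fintype A] [DecidableEq A] {α : ℝ} (hα : α ≠ 1)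
    (ρ σ : Matrix A A ℂ) :
    measuredRenyi α ρ σ = (((α - 1)⁻¹ : ℝ) : EReal) * ENNReal.log (measuredQ α ρ σ) := by
  unfold measuredRenyi measuredQ classicalRenyi
  simp only [← ENNReal.log_rpow]
  rw [iSup_sigma', iSup_sigma', iInf_sigma']
  refine (ENNReal.logOrderIso.map_iSup _).symm.trans (congrArg ENNReal.log ?_)
  split_ifs with h
  · have hc : 0 < -(α - 1)⁻¹ := neg_pos.mpr (inv_lt_zero.mpr (sub_neg.mpr h))
    rw [← neg_neg (α - 1)⁻¹, ENNReal.rpow_neg]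
    refine Eq.trans ?_ (congrArg (·⁻¹) ((ENNReal.orderIsoRpow _ hc).map_iInf _)).symm
    simp only [ENNReal.rpow_neg _ (-(α - 1)⁻¹), ENNReal.inv_iInf, ENNReal.orderIsoRpow_apply]
  · have hc : 0 < (α - 1)⁻¹ :=
      inv_pos.mpr (sub_pos.mpr (lt_of_le_of_ne (not_lt.mp h) hα.symm))
    exact ((ENNReal.orderIsoRpow _ hc).map_iSup _).symm

/-- `Q^{𝕄,rec}_α(ρ_{AD}‖σ_{AE})`: the optimum of `Q^𝕄_α(ρ_{AD}‖(𝓘_A ⊗ Γ_{E→D})(σ_{AE}))` over all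
quantum channels `Γ` from `E` to `D`, a supremum for `α < 1` and an infimum for `1 < α`. -/
def measuredRecoveryQ {A D E : Type*} [Fintype A] [DecidableEq A] [Fintype D] [DecidableEq D]
    [Fintype E] (α : ℝ) (ρ : Matrix (A × D) (A × D) ℂ) (σ : Matrix (A × E) (A × E) ℂ) : ℝ≥0∞ :=
  if α < 1 then ⨆ Γ : QuantumChannel E D, measuredQ α ρ (idTensor A Γ.toLinearMap σ)
  else ⨅ Γ : QuantumChannel E D, measuredQ α ρ (idTensor A Γ.toLinearMap σ)

/-- The measured Rényi relative entropy of recovery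
`D^{𝕄,rec}_α(ρ_{AD}‖σ_{AE}) = (α - 1)⁻¹ log Q^{𝕄,rec}_α(ρ_{AD}‖σ_{AE})`. -/
def measuredRenyiRecovery {A D E : Type*} [Fintype A] [DecidableEq A] [Fintype D] [DecidableEq D]
    [Fintype E] (α : ℝ) (ρ : Matrix (A × D) (A × D) ℂ) (σ : Matrix (A × E) (A × E) ℂ) : EReal :=
  (((α - 1)⁻¹ : ℝ) : EReal) * ENNReal.log (measuredRecoveryQ α ρ σ)

end

/-! The weighted arithmetic-geometric mean inequality linearizes the classical sum: `∑ P^α Q^(1-α)`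
is the infimum (`α < 1`) or supremum (`1 < α`) of `α ∑ P u + (1 - α) ∑ Q v` over positive weights
with `u^α v^(1-α) = 1`. With the weights attached to measurement outcomes, the measured quantity
becomes an optimization of `α tr[Xρ] + (1 - α) tr[Yσ]` over a set of operator pairs, convex by
`convex_weightedPairs`.

A channel is a positive Choi matrix with identity marginal, and the recovered state is linear in it.
The recovery quantity is therefore a minimax problem with an affine objective. In both ranges of `α`
the channel tries to maximize `tr[Y Γ(σ)]`, since `1 - α` changes sign together with the direction
of the optimization. Sion's theorem and a Lagrange multiplier `Z` for the marginal constraint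
replace this maximum by `tr Z` under `Z ⊗ 1 ≥ linkAdjoint σ Y` (`exists_dual_operator`).

Dual feasible points multiply: product measurements, product weights and `Z ⊗ Z'` are feasible for
the tensor product problem, with values `a a'` and `b b'` (`IsRecoveryBound.bipartiteTensor`).
Rescaling the weights turns the bound `α a + (1 - α) b` into the multiplicative `a^α b^(1-α)`, and
weak duality applies it to every joint recovery channel. Hence the optimal value is
submultiplicative for `α < 1` and supermultiplicative for `1 < α`; the prefactor `(α - 1)⁻¹` makes
both superadditivity. -/

noncomputable section

/-! ### Link products and partial traces -/

section LinkProduct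

variable {R E D : Type*}

/-- The link product `X * C` of an operator on `RE` and an operator on `ED`, without the
conventional transposition on the contracted system `E`. -/
def link [Fintype E] (X : Matrix (R × E) (R × E) ℂ) (C : Matrix (E × D) (E × D) ℂ) :
    Matrix (R × D) (R × D) ℂ :=
  Matrix.of fun p q => ∑ e, ∑ e', X (p.1, e) (q.1, e') * C (e, p.2) (e', q.2)

/-- The Choi matrix of a linear map. -/
def choi [DecidableEq E] (Γ : Matrix E E ℂ →ₗ[ℂ] Matrix D D ℂ) :
    Matrix (E × D) (E × D) ℂ :=
  Matrix.of fun p q => Γ (Matrix.single p.1 q.1 1) p.2 q.2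

/-- The linear map with a given Choi matrix. -/
def choiMap [Fintype E] (C : Matrix (E × D) (E × D) ℂ) : Matrix E E ℂ →ₗ[ℂ] Matrix D D ℂ where
  toFun W := Matrix.of fun d d' => ∑ e, ∑ e', W e e' * C (e, d) (e', d')
  map_add' W W' := by
    ext d d'
    simp [add_mul, Finset.sum_add_distrib]
  map_smul' c W := by
    ext d d'
    simp [Finset.mul_sum, mul_assoc]

/-- The operator on `ED` that represents the functional `C ↦ tr[Y (σ * C)]`. -/
def linkAdjoint {A : Type*} [Fintype A] (σ : Matrix (A × E) (A × E) ℂ)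
    (Y : Matrix (A × D) (A × D) ℂ) : Matrix (E × D) (E × D) ℂ :=
  link (σᵀ.submatrix Prod.swap Prod.swap) Y

theorem idTensor_choiMap [Fintype E] (C : Matrix (E × D) (E × D) ℂ)
    (X : Matrix (R × E) (R × E) ℂ) : idTensor R (choiMap C) X = link X C := rfl

theorem idTensor_eq_link [Fintype E] [DecidableEq E] (Γ : Matrix E E ℂ →ₗ[ℂ] Matrix D D ℂ)
    (X : Matrix (R × E) (R × E) ℂ) : idTensor R Γ X = link X (choi Γ) := by
  ext p q
  have h := congrFun (congrFun (congrArg Γ (Matrix.matrix_eq_sum_single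
    (Matrix.of fun e e' => X (p.1, e) (q.1, e')))) p.2) q.2
  simp only [idTensor, link, choi, of_apply] at h ⊢
  rw [h, map_sum, Matrix.sum_apply]
  refine Finset.sum_congr rfl fun e _ => ?_
  rw [map_sum, Matrix.sum_apply]
  refine Finset.sum_congr rfl fun e' _ => ?_
  have : Matrix.single e e' (X (p.1, e) (q.1, e')) =
      X (p.1, e) (q.1, e') • Matrix.single e e' (1 : ℂ) := by
    rw [Matrix.smul_single, smul_eq_mul, mul_one]
  rw [this, map_smul, Matrix.smul_apply, smul_eq_mul]

/-- The quadratic form of the summed matrix at `x` is that of `N` at `x` tensored with the all-ones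
vector. -/
theorem posSemidef_sum_blocks {P : Type*} [Finite P] [Fintype E]
    {N : Matrix (P × E) (P × E) ℂ} (hN : N.PosSemidef) :
    (Matrix.of fun p q => ∑ e, ∑ e', N (p, e) (q, e') : Matrix P P ℂ).PosSemidef := by
  have := Fintype.ofFinite P
  refine .of_dotProduct_mulVec_nonneg ?_ fun x => ?_
  · ext p q
    simp only [conjTranspose_apply, of_apply, star_sum, hN.isHermitian.apply]
    exact Finset.sum_comm
  · convert hN.dotProduct_mulVec_nonneg (fun p => x p.1) using 1
    simp only [dotProduct, mulVec, of_apply, Pi.star_apply, Fintype.sum_prod_type, Finset.mul_sum,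
      Finset.sum_mul]
    refine Finset.sum_congr rfl fun p _ => ?_
    rw [Finset.sum_comm]

theorem Matrix.PosSemidef.link [Finite R] [Fintype E] [Finite D]
    {X : Matrix (R × E) (R × E) ℂ} {C : Matrix (E × D) (E × D) ℂ} (hX : X.PosSemidef)
    (hC : C.PosSemidef) : (link X C).PosSemidef := by
  -- Identifying the two copies of `E` selects a principal submatrix of `X ⊗ C`; summing its
  -- `E`-blocks gives the link product.
  have h := posSemidef_sum_blocks ((hX.kronecker hC).submatrix
    fun p : (R × D) × E => ((p.1.1, p.2), (p.2, p.1.2)))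
  simp only [submatrix_apply, kroneckerMap_apply] at h
  exact h

theorem Matrix.PosSemidef.linkAdjoint {A : Type*} [Fintype A] [Finite E] [Finite D]
    {σ : Matrix (A × E) (A × E) ℂ} {Y : Matrix (A × D) (A × D) ℂ} (hσ : σ.PosSemidef)
    (hY : Y.PosSemidef) : (linkAdjoint σ Y).PosSemidef :=
  (hσ.transpose.submatrix _).link hY

theorem trace_mul_link {A : Type*} [Fintype A] [Fintype E] [Fintype D]
    (σ : Matrix (A × E) (A × E) ℂ) (C : Matrix (E × D) (E × D) ℂ)
    (Y : Matrix (A × D) (A × D) ℂ) :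
    (Y * link σ C).trace = (C * linkAdjoint σ Y).trace := by
  simp only [trace, diag_apply, mul_apply, link, linkAdjoint, of_apply, Fintype.sum_prod_type,
    Finset.mul_sum, submatrix_apply, transpose_apply, Prod.swap_prod_mk]
  simp only [← Fintype.sum_prod_type']
  let f : A × D × A × D × E × E ≃ E × D × E × D × A × A :=
    { toFun := fun x => (x.2.2.2.2.1, x.2.2.2.1, x.2.2.2.2.2, x.2.1, x.1, x.2.2.1)
      invFun := fun x => (x.2.2.2.2.1, x.2.2.2.1, x.2.2.2.2.2, x.2.1, x.1, x.2.2.1)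
      left_inv := fun _ => rfl
      right_inv := fun _ => rfl }
  refine Fintype.sum_equiv f _ _ fun x => ?_
  simp only [f, Equiv.coe_fn_mk]
  ring

theorem trace_mul_kronecker_one [Fintype E] [Fintype D] [DecidableEq D]
    (C : Matrix (E × D) (E × D) ℂ) (Z : Matrix E E ℂ) :
    (C * (Z ⊗ₖ (1 : Matrix D D ℂ))).trace = (marginal C * Z).trace := by
  simp only [trace, diag_apply, mul_apply, marginal, of_apply, Fintype.sum_prod_type,
    kroneckerMap_apply, one_apply, mul_ite, mul_one, mul_zero, Finset.sum_ite_eq',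
    Finset.mem_univ, if_true, Finset.sum_mul]
  refine Finset.sum_congr rfl fun e _ => ?_
  rw [Finset.sum_comm]

theorem trace_marginal [Fintype E] [Fintype D] (C : Matrix (E × D) (E × D) ℂ) :
    (marginal C).trace = C.trace := by
  simp [trace, marginal, Fintype.sum_prod_type]

theorem Matrix.PosSemidef.trace_mul_nonneg {n : Type*} [Fintype n] {X Y : Matrix n n ℂ}
    (hX : X.PosSemidef) (hY : Y.PosSemidef) : 0 ≤ (X * Y).trace := by
  classical
  obtain ⟨B, rfl⟩ : ∃ B : Matrix n n ℂ, X = Bᴴ * B := by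
    open scoped MatrixOrder in
    obtain ⟨B, h⟩ := CStarAlgebra.nonneg_iff_eq_star_mul_self.mp hX.nonneg
    exact ⟨B, h⟩
  rw [Matrix.mul_assoc, Matrix.trace_mul_comm]
  exact (hY.mul_mul_conjTranspose_same B).trace_nonneg

end LinkProduct

/-! ### Channels and their Choi matrices -/

section Channels

variable {E D : Type*} [Fintype E] [Fintype D]

theorem QuantumChannel.posSemidef_choi [DecidableEq E] (Γ : QuantumChannel E D) :
    (choi Γ.toLinearMap).PosSemidef := by
  let f := Fintype.equivFin E
  -- The unnormalized maximally entangled vector, with its reference system relabelled by `Fin` to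
  -- match the definition of complete positivity.
  let w : Fin (Fintype.card E) × E → ℂ := fun p => if f.symm p.1 = p.2 then 1 else 0
  have h := (Γ.completelyPositive _ _ (posSemidef_vecMulVec_self_star w)).submatrix
    (fun p : E × D => (f p.1, p.2))
  convert h using 1
  ext p q
  simp only [choi, idTensor, of_apply, submatrix_apply]
  refine congrFun (congrFun (congrArg Γ.toLinearMap ?_) p.2) q.2
  ext e e'
  simp only [of_apply, vecMulVec_apply, Pi.star_apply, w, f, Equiv.symm_apply_apply, single_apply]
  split_ifs <;> simp_all

theorem QuantumChannel.marginal_choi [DecidableEq E] (Γ : QuantumChannel E D) :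
    marginal (choi Γ.toLinearMap) = 1 := by
  ext e e'
  have h := Γ.tracePreserving (Matrix.single e e' 1)
  simp only [marginal, choi, of_apply, one_apply]
  rw [trace] at h
  simp only [diag_apply] at h
  rw [h]
  split_ifs with hee
  · subst hee; simp
  · simp [hee]

/-- The channel with a given Choi matrix. -/
def QuantumChannel.ofChoi [DecidableEq E] (C : Matrix (E × D) (E × D) ℂ) (hC : C.PosSemidef)
    (hC1 : marginal C = 1) : QuantumChannel E D where
  toLinearMap := choiMap C
  completelyPositive k X hX := by
    rw [idTensor_choiMap]
    exact hX.link hC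
  tracePreserving X := by
    have h : ∀ e e', ∑ d, C (e, d) (e', d) = if e = e' then 1 else 0 := fun e e' => by
      have := congrFun (congrFun hC1 e) e'
      rwa [one_apply] at this
    simp only [choiMap, LinearMap.coe_mk, AddHom.coe_mk, trace, diag_apply, of_apply]
    rw [Finset.sum_comm]
    refine Finset.sum_congr rfl fun e _ => ?_
    rw [Finset.sum_comm]
    simp only [← Finset.mul_sum, h]
    simp

end Channels

/-! ### Minimax and strong duality over recovery channels -/

section Duality

/-- A form of the minimax theorem for functions that are affine in both arguments. -/
theorem exists_forall_gt_of_affine {V U : Type*} [AddCommGroup V] [Module ℝ V]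
    [TopologicalSpace V] [IsTopologicalAddGroup V] [ContinuousSMul ℝ V] [AddCommGroup U]
    [Module ℝ U] [TopologicalSpace U] [IsTopologicalAddGroup U] [ContinuousSMul ℝ U]
    {K : Set V} (hK : K.Nonempty) (hKc : IsCompact K) (hKconv : Convex ℝ K)
    {Y : Set U} (hY : Convex ℝ Y) (f : V → U → ℝ)
    (hfx : ∀ y, Continuous fun x => f x y) (hfy : ∀ x, Continuous fun y => f x y)
    (hfx' : ∀ y x x' a b, a + b = 1 → f (a • x + b • x') y = a * f x y + b * f x' y)
    (hfy' : ∀ x y y' a b, a + b = 1 → f x (a • y + b • y') = a * f x y + b * f x y')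
    {t : ℝ} (h : ∀ x ∈ K, ∃ y ∈ Y, t < f x y) : ∃ y ∈ Y, ∀ x ∈ K, t < f x y := by
  -- Compactness of `K` leaves finitely many `y` to consider, as the finite form of Sion's theorem
  -- requires; `Y` itself need not be compact.
  obtain ⟨s, hs⟩ := hKc.elim_finite_subcover (fun y : Y => {x | t < f x y})
    (fun y => isOpen_lt continuous_const (hfx y)) fun x hx => by
      obtain ⟨y, hy, hxy⟩ := h x hx
      exact Set.mem_iUnion.mpr ⟨⟨y, hy⟩, hxy⟩
  refine Sion.exists_lt_iInf_of_lt_iInf_of_finite (f := f) hK hKc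
    (fun y _ => (hfx y).lowerSemicontinuous.lowerSemicontinuousOn _)
    (fun y _ => (ConvexOn.quasiconvexOn ⟨hKconv, fun x _ x' _ a b _ _ hab => by
      simp only [hfx' y x x' a b hab, smul_eq_mul, le_refl]⟩)) hY
    (fun x _ => (hfy x).upperSemicontinuous.upperSemicontinuousOn _)
    (fun x _ => (ConcaveOn.quasiconcaveOn ⟨hY, fun y _ y' _ a b _ _ hab => by
      simp only [hfy' x y y' a b hab, smul_eq_mul, le_refl]⟩)) hKconv
    (s := Subtype.val '' (s : Set Y)) (s.finite_toSet.image _)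
    (by rintro _ ⟨y, -, rfl⟩; exact y.2) fun x hx => ?_
  obtain ⟨y, hy, hxy⟩ := Set.mem_iUnion₂.mp (hs hx)
  exact ⟨y, ⟨y, hy, rfl⟩, hxy⟩

/-- The set is the image of a Hilbert–Schmidt sphere under the continuous map `G ↦ Gᴴ * G`. -/
theorem Matrix.isCompact_posSemidef_trace_eq {n : Type*} [Fintype n] (r : ℝ) :
    IsCompact {C : Matrix n n ℂ | C.PosSemidef ∧ C.trace = r} := by
  have hbox : IsCompact {G : Matrix n n ℂ | ∀ i j, G i j ∈ Metric.closedBall (0 : ℂ) (√r)} :=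
    isCompact_pi_infinite (X := fun _ : n => n → ℂ)
      (s := fun _ => {g | ∀ j, g j ∈ Metric.closedBall (0 : ℂ) (√r)}) fun _ =>
      isCompact_pi_infinite (X := fun _ : n => ℂ) fun _ => isCompact_closedBall _ _
  have hclosed : IsClosed {G : Matrix n n ℂ | (Gᴴ * G).trace = r} :=
    isClosed_eq (by fun_prop) continuous_const
  have hsub : {G : Matrix n n ℂ | (Gᴴ * G).trace = r} ⊆
      {G : Matrix n n ℂ | ∀ i j, G i j ∈ Metric.closedBall (0 : ℂ) (√r)} := by
    intro G hG i j
    have h : ∑ j, ∑ i, ‖G i j‖ ^ 2 = r := by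
      have := congrArg Complex.re (hG : (Gᴴ * G).trace = r)
      simpa [trace, mul_apply, ← Complex.normSq_eq_conj_mul_self, Complex.normSq_eq_norm_sq,
        ← Complex.ofReal_pow] using this
    rw [mem_closedBall_zero_iff]
    refine Real.le_sqrt_of_sq_le ?_
    rw [← h]
    exact (Finset.single_le_sum (f := fun i => ‖G i j‖ ^ 2) (fun _ _ => sq_nonneg _)
      (Finset.mem_univ i)).trans (Finset.single_le_sum (f := fun j => ∑ i, ‖G i j‖ ^ 2)
        (fun _ _ => Finset.sum_nonneg fun _ _ => sq_nonneg _) (Finset.mem_univ j))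
  convert (hbox.of_isClosed_subset hclosed hsub).image (f := fun G : Matrix n n ℂ => Gᴴ * G)
    (by fun_prop) using 1
  ext C
  simp only [Set.mem_ofPred_eq, Set.mem_image]
  constructor
  · rintro ⟨hC, hr⟩
    obtain ⟨B, rfl⟩ : ∃ B : Matrix n n ℂ, C = Bᴴ * B := by
      classical
      open scoped MatrixOrder in
      obtain ⟨B, h⟩ := CStarAlgebra.nonneg_iff_eq_star_mul_self.mp hC.nonneg
      exact ⟨B, h⟩
    exact ⟨B, hr, rfl⟩
  · rintro ⟨G, hG, rfl⟩
    exact ⟨posSemidef_conjTranspose_mul_self G, hG⟩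

theorem Matrix.PosSemidef.of_trace_mul_re_nonneg {n : Type*} [Fintype n] {M : Matrix n n ℂ}
    (hM : M.IsHermitian) {r : ℝ} (hr : 0 < r)
    (h : ∀ C : Matrix n n ℂ, C.PosSemidef → C.trace = r → 0 ≤ (C * M).trace.re) :
    M.PosSemidef := by
  refine .of_dotProduct_mulVec_nonneg hM fun x => ?_
  rw [Complex.nonneg_iff]
  refine ⟨?_, (hM.im_star_dotProduct_mulVec_self x).symm⟩
  rcases eq_or_ne x 0 with rfl | hx
  · simp
  obtain ⟨s, hs, hxs⟩ : ∃ s : ℝ, 0 < s ∧ x ⬝ᵥ star x = s := by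
    have := dotProduct_self_star_pos_iff.mpr hx
    rw [Complex.pos_iff] at this
    exact ⟨_, this.1, Complex.ext rfl this.2.symm⟩
  -- The rank-one test operator is rescaled to have the prescribed trace `r`.
  have h1 := h ((r / s : ℝ) • vecMulVec x (star x))
    ((posSemidef_vecMulVec_self_star x).smul (by positivity))
    (by
      rw [trace_smul, trace_vecMulVec, hxs, Complex.real_smul, ← Complex.ofReal_mul,
        div_mul_cancel₀ _ hs.ne'])
  rw [Matrix.smul_mul, trace_smul, vecMulVec_mul, trace_vecMulVec, Complex.smul_re, smul_eq_mul,
    dotProduct_comm, ← dotProduct_mulVec] at h1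
  exact nonneg_of_mul_nonneg_right h1 (by positivity)

theorem Matrix.IsHermitian.marginal {D E : Type*} [Fintype D] {C : Matrix (E × D) (E × D) ℂ}
    (hC : C.IsHermitian) : (marginal C).IsHermitian := by
  ext e e'
  simp only [_root_.marginal, conjTranspose_apply, of_apply, star_sum, hC.apply]

theorem marginal_smul_one {D E : Type*} [Fintype D] [DecidableEq D] [DecidableEq E] [Nonempty D] :
    marginal (((Fintype.card D : ℝ)⁻¹ : ℝ) • (1 : Matrix (E × D) (E × D) ℂ)) = 1 := by
  ext e e'
  simp only [marginal, of_apply, Matrix.smul_apply, one_apply, Prod.mk.injEq, and_true]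
  split_ifs <;> simp [*]

variable {A D E : Type*} [Fintype A] [Fintype D] [Fintype E] [DecidableEq D]

/-- Strong duality for the optimization over recovery channels. -/
theorem exists_dual_operator [Nonempty D] [Nonempty E] [DecidableEq E]
    (ρ : Matrix (A × D) (A × D) ℂ)
    {σ : Matrix (A × E) (A × E) ℂ} (hσ : σ.PosSemidef)
    {F : Set (Matrix (A × D) (A × D) ℂ × Matrix (A × D) (A × D) ℂ)} (hF : Convex ℝ F)
    (hF' : ∀ y ∈ F, y.2.PosSemidef) (p : ℝ) {l : ℝ} (hl : 0 < l) {c : ℝ}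
    (h : ∀ C : Matrix (E × D) (E × D) ℂ, C.PosSemidef → marginal C = 1 →
      ∃ y ∈ F, p * (y.1 * ρ).trace.re + l * (y.2 * link σ C).trace.re < c) :
    ∃ y ∈ F, ∃ Z : Matrix E E ℂ,
      (Z ⊗ₖ (1 : Matrix D D ℂ) - linkAdjoint σ y.2).PosSemidef ∧
      p * (y.1 * ρ).trace.re + l * Z.trace.re ≤ c := by
  let r : ℝ := Fintype.card E
  have hr : 0 < r := by positivity
  -- Only the trace part of `marginal C = 1` is kept, which suffices for compactness; the full
  -- constraint is enforced by the multiplier.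
  let K : Set (Matrix (E × D) (E × D) ℂ) := {C | C.PosSemidef ∧ C.trace = r}
  have hK : ((Fintype.card D : ℝ)⁻¹ : ℝ) • (1 : Matrix (E × D) (E × D) ℂ) ∈ K := by
    constructor
    · exact PosSemidef.one.smul (by positivity)
    · rw [← trace_marginal, marginal_smul_one]
      simp [r]
  have hKconv : Convex ℝ K := by
    rintro C ⟨hC, hCr⟩ C' ⟨hC', hCr'⟩ a b ha hb hab
    refine ⟨(hC.smul ha).add (hC'.smul hb), ?_⟩
    rw [trace_add, trace_smul, trace_smul, hCr, hCr', ← add_smul, hab, one_smul]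
  let Y : Set ((Matrix (A × D) (A × D) ℂ × Matrix (A × D) (A × D) ℂ) × Matrix E E ℂ) :=
    F ×ˢ {Z | Z.IsHermitian}
  have hY : Convex ℝ Y := hF.prod (selfAdjoint.submodule ℝ (Matrix E E ℂ)).convex
  -- The negated Lagrangian, with the Hermitian multiplier `y.2` dual to `marginal C = 1`.
  let f : Matrix (E × D) (E × D) ℂ →
      (Matrix (A × D) (A × D) ℂ × Matrix (A × D) (A × D) ℂ) × Matrix E E ℂ → ℝ := fun C y =>
    -(p * (y.1.1 * ρ).trace.re + l * ((y.1.2 * link σ C).trace.re + y.2.trace.re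
      - (marginal C * y.2).trace.re))
  obtain ⟨y, hyY, hy⟩ := exists_forall_gt_of_affine (f := f) (t := -c)
    ⟨_, hK⟩ (isCompact_posSemidef_trace_eq r) hKconv hY
    (by
      intro y
      simp only [f, marginal, link]
      fun_prop)
    (by
      intro y
      simp only [f]
      fun_prop)
    (by
      intro y C C' a b hab
      have h1 : link σ (a • C + b • C') = a • link σ C + b • link σ C' := by
        ext p q
        simp [link, mul_add, Finset.sum_add_distrib, Finset.mul_sum, mul_left_comm]
      have h2 : marginal (a • C + b • C') = a • marginal C + b • marginal C' := by
        ext p q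
        simp [marginal, Finset.sum_add_distrib, Finset.mul_sum]
      simp only [f, h1, h2, mul_add, add_mul, trace_add, Matrix.mul_smul, Matrix.smul_mul,
        trace_smul, Complex.add_re, Complex.smul_re, smul_eq_mul]
      linear_combination (p * (y.1.1 * ρ).trace.re + l * y.2.trace.re) * hab)
    (by
      intro C y y' a b hab
      simp only [f, Prod.fst_add, Prod.snd_add, Prod.smul_fst, Prod.smul_snd, mul_add, add_mul,
        trace_add, Matrix.mul_smul, Matrix.smul_mul,
        trace_smul, Complex.add_re, Complex.smul_re, smul_eq_mul]
      ring)
    (by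
      rintro C ⟨hC, hCr⟩
      by_cases hC1 : marginal C = 1
      · obtain ⟨y, hyF, hy⟩ := h C hC hC1
        refine ⟨(y, 0), ⟨hyF, isHermitian_zero⟩, ?_⟩
        simp only [f, trace_zero, mul_zero, Complex.zero_re]
        linarith
      -- When the marginal constraint fails, any element of `F` will do (the completely depolarizing
      -- channel supplies one): a large multiple of the defect `1 - marginal C` as multiplier makes
      -- the Lagrangian arbitrarily small.
      · obtain ⟨y, hyF, -⟩ := h _ (PosSemidef.one.smul (by positivity)) marginal_smul_one
        have hH : (1 - marginal C).IsHermitian := isHermitian_one.sub hC.isHermitian.marginal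
        have hpos : 0 < ((1 - marginal C) * (1 - marginal C)).trace.re := by
          have h0 := (posSemidef_conjTranspose_mul_self (1 - marginal C)).trace_nonneg
          have hne : ((1 - marginal C)ᴴ * (1 - marginal C)).trace ≠ 0 := by
            rw [Ne, trace_conjTranspose_mul_self_eq_zero_iff, sub_eq_zero]
            exact fun h => hC1 h.symm
          rw [hH.eq] at h0 hne
          exact (Complex.pos_iff.mp (h0.lt_of_ne' hne)).1
        set w := ((1 - marginal C) * (1 - marginal C)).trace.re with hw
        obtain ⟨t, ht⟩ : ∃ t : ℝ,
            p * (y.1 * ρ).trace.re + l * (y.2 * link σ C).trace.re - c < t * (l * w) :=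
          ⟨(p * (y.1 * ρ).trace.re + l * (y.2 * link σ C).trace.re - c + 1) / (l * w), by
            rw [div_mul_cancel₀ _ (mul_pos hl hpos).ne']; linarith⟩
        refine ⟨(y, (-t) • (1 - marginal C)), ⟨hyF, hH.smul (IsSelfAdjoint.all _)⟩, ?_⟩
        have hwt : ((-t) • (1 - marginal C)).trace.re
            - (marginal C * (-t) • (1 - marginal C)).trace.re = -t * w := by
          rw [hw, ← Complex.sub_re, ← trace_sub]
          conv_lhs => rw [← one_mul ((-t) • (1 - marginal C)), ← mul_assoc, mul_one, ← sub_mul,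
            Matrix.mul_smul, trace_smul, Complex.smul_re, smul_eq_mul]
        simp only [f, add_sub_assoc, hwt]
        linarith)
  obtain ⟨hyF, hZ⟩ := hyY
  -- Shifting the multiplier by `lam • 1` makes the dual value exactly `c`; the strict minimax bound
  -- on `K` then becomes positivity of the dual slack.
  let lam : ℝ := (c - (p * (y.1.1 * ρ).trace.re + l * y.2.trace.re)) / (l * r)
  refine ⟨y.1, hyF, y.2 + lam • 1, ?_, ?_⟩
  · refine .of_trace_mul_re_nonneg ?_ hr fun C hC hCr => ?_
    · have hZ' : (y.2 + lam • (1 : Matrix E E ℂ)).IsHermitian :=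
        hZ.add (isHermitian_one.smul (IsSelfAdjoint.all _))
      refine IsHermitian.sub ?_ (hσ.linkAdjoint (hF' _ hyF)).isHermitian
      rw [IsHermitian, conjTranspose_kronecker, hZ'.eq, conjTranspose_one]
    · have := hy C ⟨hC, hCr⟩
      rw [mul_sub, trace_sub, trace_mul_kronecker_one, ← trace_mul_link, mul_add, trace_add,
        Matrix.mul_smul, Matrix.mul_one, trace_smul, trace_marginal, hCr]
      simp only [f] at this
      simp only [Complex.sub_re, Complex.add_re, Complex.smul_re, Complex.ofReal_re, smul_eq_mul]
      have h2 : lam * r = (c - (p * (y.1.1 * ρ).trace.re + l * y.2.trace.re)) / l := by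
        simp only [lam]; field_simp
      rw [h2, ← mul_le_mul_iff_right₀ hl, mul_zero, mul_sub, mul_add, mul_div_cancel₀ _ hl.ne']
      linarith
  · rw [trace_add, trace_smul, trace_one]
    simp only [Complex.add_re, Complex.smul_re, Complex.natCast_re, smul_eq_mul]
    apply le_of_eq
    change _ + l * (_ + lam * r) = c
    simp only [lam]
    field_simp
    ring

end Duality

/-! ### Variational formula for the classical sum -/

section ClassicalVariational

open Filter Topology

/-- The admissible pairs of weights in the variational formula for `∑ₓ P(x)^α Q(x)^(1-α)`. -/
structure IsWeightPair (α u v : ℝ) : Prop where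
  left_pos : 0 < u
  right_pos : 0 < v
  rpow_mul_rpow : u ^ α * v ^ (1 - α) = 1

namespace IsWeightPair

variable {α u v u' v' : ℝ}

theorem one (α : ℝ) : IsWeightPair α 1 1 := ⟨one_pos, one_pos, by simp⟩

theorem mul (h : IsWeightPair α u v) (h' : IsWeightPair α u' v') :
    IsWeightPair α (u * u') (v * v') where
  left_pos := mul_pos h.left_pos h'.left_pos
  right_pos := mul_pos h.right_pos h'.right_pos
  rpow_mul_rpow := by
    rw [Real.mul_rpow h.left_pos.le h'.left_pos.le, Real.mul_rpow h.right_pos.le h'.right_pos.le,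
      mul_mul_mul_comm, h.rpow_mul_rpow, h'.rpow_mul_rpow, one_mul]

theorem of_right (hα : 0 < α) (hv : 0 < v) : IsWeightPair α (v ^ ((α - 1) / α)) v where
  left_pos := by positivity
  right_pos := hv
  rpow_mul_rpow := by
    rw [← Real.rpow_mul hv.le, div_mul_cancel₀ _ hα.ne', ← Real.rpow_add hv]
    simp

theorem of_left (hα : 1 < α) (hu : 0 < u) : IsWeightPair α u (u ^ (α / (α - 1))) where
  left_pos := hu
  right_pos := by positivity
  rpow_mul_rpow := by
    have : α - 1 ≠ 0 := (sub_pos.mpr hα).ne'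
    rw [← Real.rpow_mul hu.le, ← Real.rpow_add hu]
    convert Real.rpow_zero u using 2
    field_simp
    ring

/-- The weights that are optimal for the pair of numbers `a`, `b`. -/
theorem exists_optimal (α : ℝ) {a b : ℝ} (ha : 0 < a) (hb : 0 < b) :
    ∃ u v, IsWeightPair α u v ∧ a * u = a ^ α * b ^ (1 - α) ∧ b * v = a ^ α * b ^ (1 - α) := by
  refine ⟨(b / a) ^ (1 - α), (a / b) ^ α, ⟨by positivity, by positivity, ?_⟩, ?_, ?_⟩
  · rw [← Real.rpow_mul (by positivity), ← Real.rpow_mul (by positivity), mul_comm α,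
      ← Real.mul_rpow (by positivity) (by positivity), div_mul_div_cancel₀ ha.ne', div_self hb.ne',
      Real.one_rpow]
  · rw [Real.div_rpow hb.le ha.le, Real.rpow_sub ha 1, Real.rpow_one]
    field_simp
  · rw [Real.div_rpow ha.le hb.le, Real.rpow_sub hb 1, Real.rpow_one]
    field_simp

theorem rpow_mul_rpow_eq (h : IsWeightPair α u v) {p q : ℝ} (hp : 0 ≤ p) (hq : 0 ≤ q) :
    (p * u) ^ α * (q * v) ^ (1 - α) = p ^ α * q ^ (1 - α) := by
  rw [Real.mul_rpow hp h.left_pos.le, Real.mul_rpow hq h.right_pos.le, mul_mul_mul_comm,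
    h.rpow_mul_rpow, mul_one]

theorem rpow_mul_rpow_le (h : IsWeightPair α u v) (hα0 : 0 < α) (hα1 : α < 1) {p q : ℝ}
    (hp : 0 ≤ p) (hq : 0 ≤ q) : p ^ α * q ^ (1 - α) ≤ α * (p * u) + (1 - α) * (q * v) := by
  have hu := h.left_pos
  have hv := h.right_pos
  rw [← h.rpow_mul_rpow_eq hp hq]
  exact Real.geom_mean_le_arith_mean2_weighted hα0.le (by linarith) (by positivity)
    (by positivity) (by ring)

/-- This is the mean inequality for `x^α y^(1-α)` and `y` with weights `1/α` and `(α-1)/α`, whose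
geometric mean is `x`. The support condition is needed because the real power `0 ^ (1 - α)` is `0`
rather than `∞`. -/
theorem le_rpow_mul_rpow (h : IsWeightPair α u v) (hα : 1 < α) {p q : ℝ}
    (hp : 0 ≤ p) (hq : 0 ≤ q) (hpq : q = 0 → p = 0) :
    α * (p * u) + (1 - α) * (q * v) ≤ p ^ α * q ^ (1 - α) := by
  have hα0 : 0 < α := by linarith
  rcases hq.eq_or_lt' with hq0 | hq0
  · rw [hq0, hpq hq0, Real.zero_rpow hα0.ne']
    simp
  have hu := h.left_pos
  have hv := h.right_pos
  rw [← h.rpow_mul_rpow_eq hp hq]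
  set x := p * u with hx
  set y := q * v with hy
  have hx0 : 0 ≤ x := by positivity
  have hy0 : 0 < y := by positivity
  have := Real.geom_mean_le_arith_mean2_weighted (w₁ := 1 / α) (w₂ := (α - 1) / α)
    (p₁ := x ^ α * y ^ (1 - α)) (p₂ := y) (by positivity)
    (div_nonneg (by linarith) hα0.le) (by positivity) hy0.le (by field_simp; ring)
  rw [Real.mul_rpow (by positivity) (by positivity), ← Real.rpow_mul hx0, ← Real.rpow_mul hy0.le,
    mul_assoc, ← Real.rpow_add hy0, mul_one_div_cancel hα0.ne', Real.rpow_one,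
    show (1 - α) * (1 / α) + (α - 1) / α = 0 by field_simp; ring, Real.rpow_zero, mul_one] at this
  have h2 := mul_le_mul_of_nonneg_left this hα0.le
  have h3 : α * (1 / α * (x ^ α * y ^ (1 - α)) + (α - 1) / α * y) =
      x ^ α * y ^ (1 - α) + (α - 1) * y := by field_simp
  linarith

theorem exists_lt_of_lt_one (hα0 : 0 < α) (hα1 : α < 1) {p q r : ℝ} (hp : 0 ≤ p) (hq : 0 ≤ q)
    (hr : p ^ α * q ^ (1 - α) < r) :
    ∃ u v, IsWeightPair α u v ∧ α * (p * u) + (1 - α) * (q * v) < r := by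
  -- Optimal weights need positive arguments, so both numbers are raised by a small `δ`.
  have hcont : Continuous fun δ : ℝ => (p + δ) ^ α * (q + δ) ^ (1 - α) :=
    ((continuous_const.add continuous_id).rpow_const fun _ => Or.inr hα0.le).mul
      ((continuous_const.add continuous_id).rpow_const fun _ => Or.inr (by linarith))
  have hev : ∀ᶠ δ in 𝓝[>] (0 : ℝ), (p + δ) ^ α * (q + δ) ^ (1 - α) < r :=
    (hcont.continuousAt.eventually_lt continuousAt_const (by simpa using hr)).filter_mono
      nhdsWithin_le_nhds
  obtain ⟨δ, hδr, hδ⟩ := (hev.and self_mem_nhdsWithin).exists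
  have hδ : 0 < δ := hδ
  obtain ⟨u, v, h, hu, hv⟩ := exists_optimal α (a := p + δ) (b := q + δ) (by linarith)
    (by linarith)
  refine ⟨u, v, h, lt_of_le_of_lt ?_ hδr⟩
  have h1 : p * u ≤ (p + δ) ^ α * (q + δ) ^ (1 - α) := by
    rw [← hu]
    exact mul_le_mul_of_nonneg_right (by linarith) h.left_pos.le
  have h2 : q * v ≤ (p + δ) ^ α * (q + δ) ^ (1 - α) := by
    rw [← hv]
    exact mul_le_mul_of_nonneg_right (by linarith) h.right_pos.le
  nlinarith

/-- For `p = 0` a small `v` suffices. For `q = 0 < p` the true value is `∞`, so `r` is unconstrained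
and a large `u` exceeds it. Otherwise the optimal weights apply. -/
theorem exists_gt_of_one_lt (hα : 1 < α) {p q r : ℝ} (hp : 0 ≤ p) (hq : 0 ≤ q)
    (hr : (q = 0 → p = 0) → r < p ^ α * q ^ (1 - α)) :
    ∃ u v, IsWeightPair α u v ∧ r < α * (p * u) + (1 - α) * (q * v) := by
  have hα0 : 0 < α := by linarith
  rcases hp.eq_or_lt' with rfl | hp0
  · have hr0 : r < 0 := by simpa [Real.zero_rpow hα0.ne'] using hr fun _ => rfl
    refine ⟨_, -r / (2 * (α - 1) * (q + 1)), of_right hα0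
      (div_pos (by linarith) (by nlinarith)), ?_⟩
    have hα' : 0 < α - 1 := by linarith
    rw [zero_mul, mul_zero, zero_add, mul_div_assoc', mul_div_assoc', lt_div_iff₀ (by positivity)]
    nlinarith [mul_nonneg hq hα'.le, mul_pos hα' (neg_pos.mpr hr0),
      mul_nonneg (mul_nonneg hq hα'.le) (neg_pos.mpr hr0).le]
  · rcases hq.eq_or_lt' with rfl | hq0
    · refine ⟨(|r| + 1) / (α * p), _, of_left hα (by positivity), ?_⟩
      have : α * (p * ((|r| + 1) / (α * p))) = |r| + 1 := by field_simp
      rw [this]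
      linarith [le_abs_self r]
    · obtain ⟨u, v, h, hu, hv⟩ := exists_optimal α hp0 hq0
      refine ⟨u, v, h, ?_⟩
      rw [hu, hv]
      have := hr fun h => absurd h hq0.ne'
      linarith

end IsWeightPair

variable {𝒳 : Type*} [Fintype 𝒳] {α : ℝ} {P Q u v : 𝒳 → ℝ}

theorem classicalQ_ofReal_of_lt_one (hα0 : 0 < α) (hα1 : α < 1) (hP : ∀ x, 0 ≤ P x)
    (hQ : ∀ x, 0 ≤ Q x) :
    classicalQ α (fun x => ENNReal.ofReal (P x)) (fun x => ENNReal.ofReal (Q x)) =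
      ENNReal.ofReal (∑ x, P x ^ α * Q x ^ (1 - α)) := by
  rw [ENNReal.ofReal_sum_of_nonneg fun x _ =>
    mul_nonneg (Real.rpow_nonneg (hP x) _) (Real.rpow_nonneg (hQ x) _)]
  refine Finset.sum_congr rfl fun x _ => ?_
  rw [ENNReal.ofReal_mul (Real.rpow_nonneg (hP x) _),
    ENNReal.ofReal_rpow_of_nonneg (hP x) hα0.le,
    ENNReal.ofReal_rpow_of_nonneg (hQ x) (by linarith)]

theorem classicalQ_ofReal_of_one_lt (hα : 1 < α) (hP : ∀ x, 0 ≤ P x)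
    (hQ : ∀ x, 0 ≤ Q x) (hPQ : ∀ x, Q x = 0 → P x = 0) :
    classicalQ α (fun x => ENNReal.ofReal (P x)) (fun x => ENNReal.ofReal (Q x)) =
      ENNReal.ofReal (∑ x, P x ^ α * Q x ^ (1 - α)) := by
  have hα0 : 0 < α := by linarith
  rw [ENNReal.ofReal_sum_of_nonneg fun x _ =>
    mul_nonneg (Real.rpow_nonneg (hP x) _) (Real.rpow_nonneg (hQ x) _)]
  refine Finset.sum_congr rfl fun x _ => ?_
  rcases (hQ x).eq_or_lt' with h | h
  · simp [hPQ x h, hα0, Real.zero_rpow hα0.ne']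
  · rw [ENNReal.ofReal_mul (Real.rpow_nonneg (hP x) _),
      ENNReal.ofReal_rpow_of_nonneg (hP x) hα0.le, ENNReal.ofReal_rpow_of_pos h]

theorem classicalQ_eq_top (hα : 1 < α) {x : 𝒳} (hP : 0 < P x) (hQ : Q x = 0) :
    classicalQ α (fun x => ENNReal.ofReal (P x)) (fun x => ENNReal.ofReal (Q x)) = ⊤ := by
  refine ENNReal.sum_eq_top.mpr ⟨x, Finset.mem_univ x, ?_⟩
  simp only [hQ, ENNReal.ofReal_zero]
  rw [ENNReal.zero_rpow_of_neg (by linarith), ENNReal.mul_top]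
  exact (ENNReal.rpow_pos (by simpa using hP) ENNReal.ofReal_ne_top).ne'

theorem exists_weights_lt (hα0 : 0 < α) (hα1 : α < 1) (hP : ∀ x, 0 ≤ P x) (hQ : ∀ x, 0 ≤ Q x)
    {c : ℝ} (hc : ∑ x, P x ^ α * Q x ^ (1 - α) < c) :
    ∃ u v : 𝒳 → ℝ, (∀ x, IsWeightPair α (u x) (v x)) ∧
      α * ∑ x, P x * u x + (1 - α) * ∑ x, Q x * v x < c := by
  set T := ∑ x, P x ^ α * Q x ^ (1 - α) with hT
  -- The slack is shared among the outcomes; the extra `1` keeps the total strict and covers an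
  -- empty outcome set.
  have hε : 0 < (c - T) / (Fintype.card 𝒳 + 1) := div_pos (by linarith) (by positivity)
  choose u v h huv using fun x => IsWeightPair.exists_lt_of_lt_one hα0 hα1 (hP x) (hQ x)
    (lt_add_of_pos_right (P x ^ α * Q x ^ (1 - α)) hε)
  refine ⟨u, v, h, ?_⟩
  have := Finset.sum_le_sum fun x (_ : x ∈ Finset.univ) => (huv x).le
  rw [Finset.sum_add_distrib, Finset.sum_add_distrib, ← Finset.mul_sum, ← Finset.mul_sum, ← hT,
    Finset.sum_const, Finset.card_univ, nsmul_eq_mul] at this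
  refine this.trans_lt ?_
  have h2 : (Fintype.card 𝒳 + 1 : ℝ) * ((c - T) / (Fintype.card 𝒳 + 1)) = c - T := by field_simp
  linarith

theorem exists_weights_gt (hα : 1 < α) (hP : ∀ x, 0 ≤ P x) (hQ : ∀ x, 0 ≤ Q x) {c : ℝ}
    (hc0 : 0 ≤ c) (hc : ENNReal.ofReal c <
      classicalQ α (fun x => ENNReal.ofReal (P x)) (fun x => ENNReal.ofReal (Q x))) :
    ∃ u v : 𝒳 → ℝ, (∀ x, IsWeightPair α (u x) (v x)) ∧
      c < α * ∑ x, P x * u x + (1 - α) * ∑ x, Q x * v x := by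
  classical
  suffices ∃ g : 𝒳 → ℝ, (∀ x, (Q x = 0 → P x = 0) → g x < P x ^ α * Q x ^ (1 - α)) ∧
      c < ∑ x, g x by
    obtain ⟨g, hg, hcg⟩ := this
    choose u v h huv using fun x => IsWeightPair.exists_gt_of_one_lt hα (hP x) (hQ x) (hg x)
    refine ⟨u, v, h, hcg.trans_le ?_⟩
    have := Finset.sum_le_sum fun x (_ : x ∈ Finset.univ) => (huv x).le
    rwa [Finset.sum_add_distrib, ← Finset.mul_sum, ← Finset.mul_sum] at this
  by_cases hPQ : ∀ x, Q x = 0 → P x = 0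
  · rw [classicalQ_ofReal_of_one_lt hα hP hQ hPQ, ENNReal.ofReal_lt_ofReal_iff_of_nonneg hc0] at hc
    set T := ∑ x, P x ^ α * Q x ^ (1 - α) with hT
    have hε : 0 < (T - c) / (Fintype.card 𝒳 + 1) := div_pos (by linarith) (by positivity)
    refine ⟨fun x => P x ^ α * Q x ^ (1 - α) - (T - c) / (Fintype.card 𝒳 + 1),
      fun x _ => by linarith, ?_⟩
    rw [Finset.sum_sub_distrib, ← hT, Finset.sum_const, Finset.card_univ, nsmul_eq_mul]
    have h2 : (Fintype.card 𝒳 + 1 : ℝ) * ((T - c) / (Fintype.card 𝒳 + 1)) = T - c := by field_simp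
    linarith
  · push Not at hPQ
    obtain ⟨x₀, hQ0, hP0⟩ := hPQ
    -- The infinite term at `x₀` admits any target, so it compensates the `-1` placed at every other
    -- outcome.
    refine ⟨fun x => if x = x₀ then c + Fintype.card 𝒳 + 1 else -1, fun x hx => ?_, ?_⟩
    · have hne : x ≠ x₀ := by
        rintro rfl
        exact hP0 (hx hQ0)
      simp only [if_neg hne]
      have := mul_nonneg (Real.rpow_nonneg (hP x) α) (Real.rpow_nonneg (hQ x) (1 - α))
      linarith
    · have : ∀ x : 𝒳, (if x = x₀ then c + Fintype.card 𝒳 + 1 else (-1 : ℝ)) =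
          (if x = x₀ then c + Fintype.card 𝒳 + 2 else 0) + -1 := fun x => by
        split_ifs <;> ring
      simp only [this, Finset.sum_add_distrib, Finset.sum_ite_eq', Finset.mem_univ, if_true,
        Finset.sum_const, Finset.card_univ, nsmul_eq_mul]
      linarith

/-- Multiplying all weights by the pair optimal for `∑ P u` and `b` turns the arithmetic bound into
a geometric one. -/
theorem sum_rpow_mul_rpow_le (hα0 : 0 < α) (hα1 : α < 1) (hP : ∀ x, 0 ≤ P x)
    (hQ : ∀ x, 0 ≤ Q x) (h : ∀ x, IsWeightPair α (u x) (v x)) {b : ℝ}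
    (ha : 0 < ∑ x, P x * u x) (hb : 0 < b) (hQb : ∑ x, Q x * v x ≤ b) :
    ∑ x, P x ^ α * Q x ^ (1 - α) ≤ (∑ x, P x * u x) ^ α * b ^ (1 - α) := by
  obtain ⟨s, t, hst, hs, ht⟩ := IsWeightPair.exists_optimal α ha hb
  have := Finset.sum_le_sum fun x (_ : x ∈ Finset.univ) =>
    ((h x).mul hst).rpow_mul_rpow_le hα0 hα1 (hP x) (hQ x)
  rw [Finset.sum_add_distrib, ← Finset.mul_sum, ← Finset.mul_sum] at this
  simp only [← mul_assoc, ← Finset.sum_mul] at this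
  rw [mul_assoc α, mul_assoc (1 - α), hs] at this
  have h2 := mul_le_mul_of_nonneg_right hQb hst.right_pos.le
  rw [ht] at h2
  have h3 := mul_le_mul_of_nonneg_left h2 (show 0 ≤ 1 - α by linarith)
  linarith

theorem le_classicalQ (hα : 1 < α) (hP : ∀ x, 0 ≤ P x)
    (hQ : ∀ x, 0 ≤ Q x) (h : ∀ x, IsWeightPair α (u x) (v x)) {b : ℝ}
    (ha : 0 < ∑ x, P x * u x) (hb : 0 < b) (hQb : ∑ x, Q x * v x ≤ b) :
    ENNReal.ofReal ((∑ x, P x * u x) ^ α * b ^ (1 - α)) ≤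
      classicalQ α (fun x => ENNReal.ofReal (P x)) (fun x => ENNReal.ofReal (Q x)) := by
  by_cases hPQ : ∀ x, Q x = 0 → P x = 0
  · rw [classicalQ_ofReal_of_one_lt hα hP hQ hPQ]
    refine ENNReal.ofReal_le_ofReal ?_
    obtain ⟨s, t, hst, hs, ht⟩ := IsWeightPair.exists_optimal α ha hb
    have := Finset.sum_le_sum fun x (_ : x ∈ Finset.univ) =>
      ((h x).mul hst).le_rpow_mul_rpow hα (hP x) (hQ x) (hPQ x)
    rw [Finset.sum_add_distrib, ← Finset.mul_sum, ← Finset.mul_sum] at this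
    simp only [← mul_assoc, ← Finset.sum_mul] at this
    rw [mul_assoc α, mul_assoc (1 - α), hs] at this
    have h2 := mul_le_mul_of_nonneg_right hQb hst.right_pos.le
    rw [ht] at h2
    have h3 := mul_le_mul_of_nonneg_left h2 (show 0 ≤ α - 1 by linarith)
    linarith
  · push Not at hPQ
    obtain ⟨x, hQ0, hP0⟩ := hPQ
    rw [classicalQ_eq_top hα ((hP x).lt_of_ne' hP0) hQ0]
    exact le_top

end ClassicalVariational

/-! ### Measurements with weighted outcomes -/

section Measurements

variable {S : Type*} [DecidableEq S]

/-- Relabelling the outcomes of a measurement. -/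
def POVM.reindex {𝒳 𝒴 : Type*} [Fintype 𝒳] [Fintype 𝒴] (M : POVM 𝒳 S) (e : 𝒴 ≃ 𝒳) :
    POVM 𝒴 S where
  op y := M.op (e y)
  posSemidef y := M.posSemidef (e y)
  sum_eq_one := (Equiv.sum_comp e M.op).trans M.sum_eq_one

/-- A random choice between two measurements. -/
def POVM.mix {𝒳 𝒴 : Type*} [Fintype 𝒳] [Fintype 𝒴] (M : POVM 𝒳 S) (N : POVM 𝒴 S) {a b : ℝ}
    (ha : 0 ≤ a) (hb : 0 ≤ b) (hab : a + b = 1) : POVM (𝒳 ⊕ 𝒴) S where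
  op := Sum.elim (fun x => a • M.op x) (fun y => b • N.op y)
  posSemidef := by
    rintro (x | y)
    · exact (M.posSemidef x).smul ha
    · exact (N.posSemidef y).smul hb
  sum_eq_one := by
    simp [← Finset.smul_sum, M.sum_eq_one, N.sum_eq_one, ← add_smul, hab]

theorem POVM.sum_stat [Fintype S] {𝒳 : Type*} [Fintype 𝒳] (M : POVM 𝒳 S) (ρ : Matrix S S ℂ) :
    ∑ x, (M.op x * ρ).trace.re = ρ.trace.re := by
  rw [← Complex.re_sum, ← trace_sum, ← Finset.sum_mul, M.sum_eq_one, one_mul]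

theorem POVM.trace_re_nonneg [Fintype S] {𝒳 : Type*} [Fintype 𝒳] (M : POVM 𝒳 S) {ρ : Matrix S S ℂ}
    (hρ : ρ.PosSemidef) (x : 𝒳) : 0 ≤ (M.op x * ρ).trace.re :=
  (Complex.nonneg_iff.mp ((M.posSemidef x).trace_mul_nonneg hρ)).1

/-- The weighted sum of the measurement operators. -/
def POVM.weighted {𝒳 : Type*} [Fintype 𝒳] (M : POVM 𝒳 S) (u : 𝒳 → ℝ) : Matrix S S ℂ :=
  ∑ x, u x • M.op x

theorem POVM.posSemidef_weighted {𝒳 : Type*} [Fintype 𝒳] (M : POVM 𝒳 S) {u : 𝒳 → ℝ}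
    (hu : ∀ x, 0 ≤ u x) : (M.weighted u).PosSemidef :=
  posSemidef_sum _ fun x _ => (M.posSemidef x).smul (hu x)

theorem POVM.trace_weighted_mul [Fintype S] {𝒳 : Type*} [Fintype 𝒳] (M : POVM 𝒳 S) (u : 𝒳 → ℝ)
    (ρ : Matrix S S ℂ) :
    (M.weighted u * ρ).trace.re = ∑ x, (M.op x * ρ).trace.re * u x := by
  simp only [weighted, Finset.sum_mul, trace_sum, Complex.re_sum, Matrix.smul_mul, trace_smul,
    Complex.smul_re, smul_eq_mul, mul_comm]

theorem POVM.weighted_reindex {𝒳 𝒴 : Type*} [Fintype 𝒳] [Fintype 𝒴] (M : POVM 𝒳 S) (e : 𝒴 ≃ 𝒳)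
    (u : 𝒳 → ℝ) : (M.reindex e).weighted (u ∘ e) = M.weighted u :=
  Equiv.sum_comp e fun x => u x • M.op x

/-- The pairs of operators that appear in the variational formula for `measuredQ`. -/
def weightedPairs (α : ℝ) (S : Type*) [DecidableEq S] :
    Set (Matrix S S ℂ × Matrix S S ℂ) :=
  {y | ∃ (n : ℕ) (M : POVM (Fin n) S) (u v : Fin n → ℝ), (∀ x, IsWeightPair α (u x) (v x)) ∧
    (M.weighted u, M.weighted v) = y}

theorem mem_weightedPairs {α : ℝ} {𝒳 : Type*} [Fintype 𝒳] (M : POVM 𝒳 S) {u v : 𝒳 → ℝ}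
    (h : ∀ x, IsWeightPair α (u x) (v x)) :
    (M.weighted u, M.weighted v) ∈ weightedPairs α S :=
  ⟨_, M.reindex (Fintype.equivFin 𝒳).symm, u ∘ (Fintype.equivFin 𝒳).symm,
    v ∘ (Fintype.equivFin 𝒳).symm, fun x => h _, by
      rw [M.weighted_reindex, M.weighted_reindex]⟩

/-- A biased coin selects one of two measurements while each outcome keeps its own weights, so the
nonlinear constraint on the weights is never mixed. -/
theorem convex_weightedPairs (α : ℝ) : Convex ℝ (weightedPairs α S) := by
  rintro _ ⟨n, M, u, v, h, rfl⟩ _ ⟨m, N, u', v', h', rfl⟩ a b ha hb hab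
  have : (a • (M.weighted u, M.weighted v) + b • (N.weighted u', N.weighted v') :
      Matrix S S ℂ × Matrix S S ℂ) = ((M.mix N ha hb hab).weighted (Sum.elim u u'),
      (M.mix N ha hb hab).weighted (Sum.elim v v')) := by
    simp [POVM.weighted, POVM.mix, Finset.smul_sum, smul_comm a, smul_comm b]
  rw [this]
  exact mem_weightedPairs _ (Sum.rec h h')

theorem posSemidef_snd_of_mem_weightedPairs {α : ℝ} {y : Matrix S S ℂ × Matrix S S ℂ}
    (hy : y ∈ weightedPairs α S) : y.2.PosSemidef := by
  obtain ⟨n, M, u, v, h, rfl⟩ := hy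
  exact M.posSemidef_weighted fun x => (h x).right_pos.le

end Measurements

/-! ### Tensor products and weak duality -/

section TensorProducts

variable {A B A' B' D E : Type*}

theorem bipartiteTensor_apply (ρ : Matrix (A × B) (A × B) ℂ) (τ : Matrix (A' × B') (A' × B') ℂ)
    (p q : (A × A') × (B × B')) : bipartiteTensor ρ τ p q =
      ρ (p.1.1, p.2.1) (q.1.1, q.2.1) * τ (p.1.2, p.2.2) (q.1.2, q.2.2) := rfl

theorem Matrix.PosSemidef.bipartiteTensor [Finite A] [Finite B] [Finite A'] [Finite B']
    {ρ : Matrix (A × B) (A × B) ℂ} {τ : Matrix (A' × B') (A' × B') ℂ} (hρ : ρ.PosSemidef)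
    (hτ : τ.PosSemidef) : (bipartiteTensor ρ τ).PosSemidef :=
  (hρ.kronecker hτ).submatrix _

theorem bipartiteTensor_mul [Fintype A] [Fintype B] [Fintype A'] [Fintype B']
    (ρ σ : Matrix (A × B) (A × B) ℂ) (τ ω : Matrix (A' × B') (A' × B') ℂ) :
    bipartiteTensor ρ τ * bipartiteTensor σ ω = bipartiteTensor (ρ * σ) (τ * ω) := by
  rw [bipartiteTensor, bipartiteTensor, submatrix_mul_equiv, ← mul_kronecker_mul]
  rfl

theorem trace_bipartiteTensor [Fintype A] [Fintype B] [Fintype A'] [Fintype B']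
    (ρ : Matrix (A × B) (A × B) ℂ) (τ : Matrix (A' × B') (A' × B') ℂ) :
    (bipartiteTensor ρ τ).trace = ρ.trace * τ.trace := by
  rw [← trace_kronecker]
  exact Equiv.sum_comp (Equiv.prodProdProdComm A A' B B') fun x => (ρ ⊗ₖ τ) x x

theorem bipartiteTensor_one [DecidableEq A] [DecidableEq B] [DecidableEq A'] [DecidableEq B'] :
    bipartiteTensor (1 : Matrix (A × B) (A × B) ℂ) (1 : Matrix (A' × B') (A' × B') ℂ) = 1 := by
  rw [bipartiteTensor, one_kronecker_one, submatrix_one_equiv]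

theorem bipartiteTensor_kronecker_one [DecidableEq B] [DecidableEq B'] (Z : Matrix A A ℂ)
    (Z' : Matrix A' A' ℂ) :
    bipartiteTensor (Z ⊗ₖ (1 : Matrix B B ℂ)) (Z' ⊗ₖ (1 : Matrix B' B' ℂ)) =
      (Z ⊗ₖ Z') ⊗ₖ (1 : Matrix (B × B') (B × B') ℂ) := by
  rw [← one_kronecker_one]
  ext p q
  simp only [bipartiteTensor_apply, kroneckerMap_apply]
  ring

theorem linkAdjoint_bipartiteTensor {D' : Type*} [Fintype A] [Fintype A']
    (σ : Matrix (A × B) (A × B) ℂ) (ω : Matrix (A' × B') (A' × B') ℂ)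
    (Y : Matrix (A × D) (A × D) ℂ) (Y' : Matrix (A' × D') (A' × D') ℂ) :
    linkAdjoint (bipartiteTensor σ ω) (bipartiteTensor Y Y') =
      bipartiteTensor (linkAdjoint σ Y) (linkAdjoint ω Y') := by
  ext p q
  simp only [bipartiteTensor_apply, linkAdjoint, link, of_apply, submatrix_apply, transpose_apply,
    Prod.swap_prod_mk, Fintype.sum_prod_type, Finset.sum_mul_sum]
  refine Finset.sum_congr rfl fun a _ => Finset.sum_congr rfl fun a' _ =>
    Finset.sum_congr rfl fun b _ => Finset.sum_congr rfl fun b' _ => ?_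
  ring

/-- Telescoping: `S ⊗ S' - W ⊗ W' = (S - W) ⊗ S' + W ⊗ (S' - W')`. -/
theorem posSemidef_bipartiteTensor_sub [Finite A] [Finite B] [Finite A'] [Finite B']
    {S W : Matrix (A × B) (A × B) ℂ} {S' W' : Matrix (A' × B') (A' × B') ℂ}
    (hW : W.PosSemidef) (hS' : S'.PosSemidef) (h : (S - W).PosSemidef)
    (h' : (S' - W').PosSemidef) :
    (bipartiteTensor S S' - bipartiteTensor W W').PosSemidef := by
  convert (h.bipartiteTensor hS').add (hW.bipartiteTensor h') using 1
  ext p q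
  simp only [bipartiteTensor_apply, Matrix.sub_apply, Matrix.add_apply]
  ring

/-- The product of two measurements on bipartite systems. -/
def POVM.bipartite {𝒳 𝒳' : Type*} [Fintype 𝒳] [Fintype 𝒳'] [Fintype A] [Fintype B]
    [Fintype A'] [Fintype B'] [DecidableEq A] [DecidableEq B] [DecidableEq A'] [DecidableEq B']
    (M : POVM 𝒳 (A × B)) (M' : POVM 𝒳' (A' × B')) :
    POVM (𝒳 × 𝒳') ((A × A') × (B × B')) where
  op x := bipartiteTensor (M.op x.1) (M'.op x.2)
  posSemidef x := (M.posSemidef x.1).bipartiteTensor (M'.posSemidef x.2)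
  sum_eq_one := by
    rw [← bipartiteTensor_one, ← M.sum_eq_one, ← M'.sum_eq_one]
    ext p q
    simp only [bipartiteTensor_apply, Matrix.sum_apply, Fintype.sum_prod_type, Finset.sum_mul_sum]

theorem POVM.weighted_bipartite {𝒳 𝒳' : Type*} [Fintype 𝒳] [Fintype 𝒳'] [Fintype A] [Fintype B]
    [Fintype A'] [Fintype B'] [DecidableEq A] [DecidableEq B] [DecidableEq A'] [DecidableEq B']
    (M : POVM 𝒳 (A × B)) (M' : POVM 𝒳' (A' × B')) (u : 𝒳 → ℝ) (u' : 𝒳' → ℝ) :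
    (M.bipartite M').weighted (fun x => u x.1 * u' x.2) =
      bipartiteTensor (M.weighted u) (M'.weighted u') := by
  ext p q
  simp only [POVM.weighted, POVM.bipartite, bipartiteTensor_apply, Matrix.sum_apply,
    Fintype.sum_prod_type, Finset.sum_mul_sum, Matrix.smul_apply, Complex.real_smul]
  refine Finset.sum_congr rfl fun x _ => Finset.sum_congr rfl fun x' _ => ?_
  push_cast
  ring

theorem IsDensityOperator.bipartiteTensor [Fintype A] [Fintype B] [Fintype A'] [Fintype B']
    {ρ : Matrix (A × B) (A × B) ℂ} {τ : Matrix (A' × B') (A' × B') ℂ}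
    (hρ : IsDensityOperator ρ)
    (hτ : IsDensityOperator τ) : IsDensityOperator (bipartiteTensor ρ τ) where
  posSemidef := hρ.posSemidef.bipartiteTensor hτ.posSemidef
  trace_eq_one := by rw [trace_bipartiteTensor, hρ.trace_eq_one, hτ.trace_eq_one, one_mul]

theorem posSemidef_of_kronecker_one_sub_linkAdjoint [Fintype A] [Fintype D] [DecidableEq D]
    [Fintype E] [Nonempty D] {σ : Matrix (A × E) (A × E) ℂ} {Z : Matrix E E ℂ}
    (hσ : σ.PosSemidef) {Y : Matrix (A × D) (A × D) ℂ} (hY : Y.PosSemidef)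
    (h : (Z ⊗ₖ (1 : Matrix D D ℂ) - linkAdjoint σ Y).PosSemidef) : Z.PosSemidef := by
  obtain ⟨d⟩ := ‹Nonempty D›
  have := (h.add (hσ.linkAdjoint hY)).submatrix fun e : E => (e, d)
  rw [sub_add_cancel] at this
  convert this using 1
  ext e e'
  simp

/-- Weak duality: pair the dual slack with the Choi matrix, whose identity marginal turns `Z ⊗ 1`
into `tr Z`. -/
theorem trace_mul_idTensor_le [Fintype A] [Fintype D] [DecidableEq D] [Fintype E]
    {σ : Matrix (A × E) (A × E) ℂ} {Y : Matrix (A × D) (A × D) ℂ} {Z : Matrix E E ℂ}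
    (h : (Z ⊗ₖ (1 : Matrix D D ℂ) - linkAdjoint σ Y).PosSemidef) (Γ : QuantumChannel E D) :
    (Y * idTensor A Γ.toLinearMap σ).trace.re ≤ Z.trace.re := by
  classical
  have := (Complex.nonneg_iff.mp (Γ.posSemidef_choi.trace_mul_nonneg h)).1
  rw [mul_sub, trace_sub, trace_mul_kronecker_one, ← trace_mul_link, Γ.marginal_choi, one_mul,
    ← idTensor_eq_link, Complex.sub_re] at this
  linarith

theorem IsDensityOperator.idTensor [Fintype A] [Fintype E] [Fintype D]
    {σ : Matrix (A × E) (A × E) ℂ} (hσ : IsDensityOperator σ) (Γ : QuantumChannel E D) :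
    IsDensityOperator (idTensor A Γ.toLinearMap σ) where
  posSemidef := by
    classical
    rw [idTensor_eq_link]
    exact hσ.posSemidef.link Γ.posSemidef_choi
  trace_eq_one := by
    rw [← hσ.trace_eq_one]
    simp only [trace, diag_apply, Fintype.sum_prod_type]
    refine Finset.sum_congr rfl fun x _ => ?_
    exact Γ.tracePreserving (Matrix.of fun e e' => σ (x, e) (x, e'))

end TensorProducts

/-! ### Dual bounds and multiplicativity of the recovery quantity -/

section Recovery

/-- The pair `(a, b)` is attained in the dual variational problem for the measured Rényi relative
entropy of recovery: weights on the outcomes of a measurement give the expectation value `a` in the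
state `ρ`, and `b` is the trace of an operator that bounds the expectation value in each state
recovered from `σ`. -/
def IsRecoveryBound {A D E : Type*} [Fintype A] [DecidableEq A] [Fintype D] [DecidableEq D]
    [Fintype E] (α : ℝ) (ρ : Matrix (A × D) (A × D) ℂ) (σ : Matrix (A × E) (A × E) ℂ)
    (a b : ℝ) : Prop :=
  ∃ y ∈ weightedPairs α (A × D), ∃ Z : Matrix E E ℂ,
    (Z ⊗ₖ (1 : Matrix D D ℂ) - linkAdjoint σ y.2).PosSemidef ∧
    (y.1 * ρ).trace.re = a ∧ Z.trace.re = b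

variable {A D E A' D' E' : Type*}
    [Fintype A] [DecidableEq A] [Fintype D] [DecidableEq D] [Fintype E]
    [Fintype A'] [DecidableEq A'] [Fintype D'] [DecidableEq D'] [Fintype E']
    {ρ : Matrix (A × D) (A × D) ℂ} {τ : Matrix (A' × D') (A' × D') ℂ}
    {σ : Matrix (A × E) (A × E) ℂ} {ω : Matrix (A' × E') (A' × E') ℂ}
    {α a b a' b' : ℝ}

theorem IsDensityOperator.nonempty {S : Type*} [Fintype S] {ρ : Matrix S S ℂ}
    (hρ : IsDensityOperator ρ) : Nonempty S := by
  by_contra h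
  rw [not_nonempty_iff] at h
  have := hρ.trace_eq_one
  simp [trace] at this

theorem IsRecoveryBound.nonneg [Nonempty D] (h : IsRecoveryBound α ρ σ a b)
    (hσ : σ.PosSemidef) : 0 ≤ b := by
  obtain ⟨y, hy, Z, hZ, -, rfl⟩ := h
  exact (Complex.nonneg_iff.mp (posSemidef_of_kronecker_one_sub_linkAdjoint hσ
    (posSemidef_snd_of_mem_weightedPairs hy) hZ).trace_nonneg).1

theorem IsRecoveryBound.bipartiteTensor [Nonempty D] [Nonempty D']
    (h : IsRecoveryBound α ρ σ a b) (h' : IsRecoveryBound α τ ω a' b')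
    (hρ : ρ.PosSemidef) (hσ : σ.PosSemidef) (hω : ω.PosSemidef) :
    IsRecoveryBound α (bipartiteTensor ρ τ) (bipartiteTensor σ ω) (a * a') (b * b') := by
  obtain ⟨_, ⟨n, M, u, v, huv, rfl⟩, Z, hZ, rfl, rfl⟩ := h
  obtain ⟨_, ⟨n', M', u', v', huv', rfl⟩, Z', hZ', rfl, rfl⟩ := h'
  have hY := M.posSemidef_weighted fun x => (huv x).right_pos.le
  have hY' := M'.posSemidef_weighted fun x => (huv' x).right_pos.le
  refine ⟨_, mem_weightedPairs (M.bipartite M') (u := fun x => u x.1 * u' x.2)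
    (v := fun x => v x.1 * v' x.2) fun x => (huv x.1).mul (huv' x.2), Z ⊗ₖ Z', ?_, ?_, ?_⟩
  · simp only [POVM.weighted_bipartite, linkAdjoint_bipartiteTensor,
      ← bipartiteTensor_kronecker_one]
    refine posSemidef_bipartiteTensor_sub (hσ.linkAdjoint hY) ?_ hZ hZ'
    rw [← sub_add_cancel (Z' ⊗ₖ (1 : Matrix D' D' ℂ)) (linkAdjoint ω (M'.weighted v'))]
    exact hZ'.add (hω.linkAdjoint hY')
  · have hX := M.posSemidef_weighted fun x => (huv x).left_pos.le
    simp only [POVM.weighted_bipartite, bipartiteTensor_mul, trace_bipartiteTensor]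
    rw [Complex.mul_re, ← (Complex.nonneg_iff.mp (hX.trace_mul_nonneg hρ)).2, zero_mul, sub_zero]
  · have hZp := posSemidef_of_kronecker_one_sub_linkAdjoint hσ hY hZ
    rw [trace_kronecker, Complex.mul_re, ← (Complex.nonneg_iff.mp hZp.trace_nonneg).2, zero_mul,
      sub_zero]

theorem sum_mul_pos_of_sum_eq_one {𝒳 : Type*} [Fintype 𝒳] {P u : 𝒳 → ℝ} (hP : ∀ x, 0 ≤ P x)
    (hP1 : ∑ x, P x = 1) (hu : ∀ x, 0 < u x) : 0 < ∑ x, P x * u x := by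
  refine Finset.sum_pos' (fun x _ => mul_nonneg (hP x) (hu x).le) ?_
  by_contra! h
  have : ∑ x, P x ≤ 0 := Finset.sum_nonpos fun x hx =>
    nonpos_of_mul_nonpos_left (h x hx) (hu x)
  linarith

theorem POVM.trace_weighted_mul_pos {S 𝒳 : Type*} [Fintype S] [DecidableEq S] [Fintype 𝒳]
    (M : POVM 𝒳 S) {u : 𝒳 → ℝ} (hu : ∀ x, 0 < u x) {ρ : Matrix S S ℂ}
    (hρ : IsDensityOperator ρ) : 0 < (M.weighted u * ρ).trace.re := by
  rw [M.trace_weighted_mul]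
  exact sum_mul_pos_of_sum_eq_one (M.trace_re_nonneg hρ.posSemidef)
    (by rw [M.sum_stat, hρ.trace_eq_one, Complex.one_re]) hu

theorem IsRecoveryBound.left_pos (h : IsRecoveryBound α ρ σ a b) (hρ : IsDensityOperator ρ) :
    0 < a := by
  obtain ⟨_, ⟨n, M, u, v, huv, rfl⟩, Z, hZ, rfl, rfl⟩ := h
  exact M.trace_weighted_mul_pos (fun x => (huv x).left_pos) hρ

theorem IsRecoveryBound.right_pos (h : IsRecoveryBound α ρ σ a b) (hσ : IsDensityOperator σ)
    (Γ : QuantumChannel E D) : 0 < b := by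
  obtain ⟨_, ⟨n, M, u, v, huv, rfl⟩, Z, hZ, rfl, rfl⟩ := h
  exact (M.trace_weighted_mul_pos (fun x => (huv x).right_pos) (hσ.idTensor Γ)).trans_le
    (trace_mul_idTensor_le hZ Γ)

theorem IsRecoveryBound.measuredQ_le (h : IsRecoveryBound α ρ σ a b) (hα0 : 0 < α) (hα1 : α < 1)
    (hρ : IsDensityOperator ρ) (hσ : IsDensityOperator σ) (Γ : QuantumChannel E D) :
    measuredQ α ρ (idTensor A Γ.toLinearMap σ) ≤ ENNReal.ofReal (a ^ α * b ^ (1 - α)) := by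
  have hb := h.right_pos hσ Γ
  have ha := h.left_pos hρ
  obtain ⟨_, ⟨n, M, u, v, huv, rfl⟩, Z, hZ, rfl, rfl⟩ := h
  rw [measuredQ, if_pos hα1]
  refine iInf₂_le_of_le n M ?_
  have hP := M.trace_re_nonneg hρ.posSemidef
  have hQ := M.trace_re_nonneg (hσ.idTensor Γ).posSemidef
  have hle := trace_mul_idTensor_le hZ Γ
  simp only [M.trace_weighted_mul] at ha hle ⊢
  exact (classicalQ_ofReal_of_lt_one hα0 hα1 hP hQ).trans_le
    (ENNReal.ofReal_le_ofReal (sum_rpow_mul_rpow_le hα0 hα1 hP hQ huv ha hb hle))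

theorem IsRecoveryBound.le_measuredQ (h : IsRecoveryBound α ρ σ a b) (hα : 1 < α)
    (hρ : IsDensityOperator ρ) (hσ : IsDensityOperator σ) (Γ : QuantumChannel E D) :
    ENNReal.ofReal (a ^ α * b ^ (1 - α)) ≤ measuredQ α ρ (idTensor A Γ.toLinearMap σ) := by
  have hb := h.right_pos hσ Γ
  have ha := h.left_pos hρ
  obtain ⟨_, ⟨n, M, u, v, huv, rfl⟩, Z, hZ, rfl, rfl⟩ := h
  rw [measuredQ, if_neg hα.not_gt]
  refine le_iSup₂_of_le n M ?_
  have hP := M.trace_re_nonneg hρ.posSemidef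
  have hQ := M.trace_re_nonneg (hσ.idTensor Γ).posSemidef
  have hle := trace_mul_idTensor_le hZ Γ
  simp only [M.trace_weighted_mul] at ha hle ⊢
  exact le_classicalQ hα hP hQ huv ha hb hle

theorem exists_isRecoveryBound_of_measuredRecoveryQ_lt (hα0 : 0 < α) (hα1 : α < 1)
    (hρ : IsDensityOperator ρ) (hσ : IsDensityOperator σ) {c : ℝ}
    (hc : measuredRecoveryQ α ρ σ < ENNReal.ofReal c) :
    ∃ a b, IsRecoveryBound α ρ σ a b ∧ α * a + (1 - α) * b ≤ c := by
  classical
  have : Nonempty D := (nonempty_prod.mp hρ.nonempty).2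
  have : Nonempty E := (nonempty_prod.mp hσ.nonempty).2
  rw [measuredRecoveryQ, if_pos hα1] at hc
  -- The pair attained for each channel may depend on that channel; duality yields a single pair and
  -- multiplier for all of them.
  obtain ⟨y, hy, Z, hZ, hle⟩ := exists_dual_operator ρ hσ.posSemidef
    (convex_weightedPairs α) (fun y hy => posSemidef_snd_of_mem_weightedPairs hy) α
    (sub_pos.mpr hα1) (c := c) fun C hC hC1 => by
      have h := (le_iSup _ (QuantumChannel.ofChoi C hC hC1)).trans_lt hc
      have hpos := (hσ.idTensor (QuantumChannel.ofChoi C hC hC1)).posSemidef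
      change (link σ C).PosSemidef at hpos
      change measuredQ α ρ (link σ C) < _ at h
      rw [measuredQ, if_pos hα1, iInf_lt_iff] at h
      obtain ⟨n, h⟩ := h
      rw [iInf_lt_iff] at h
      obtain ⟨M, h⟩ := h
      have hP := M.trace_re_nonneg hρ.posSemidef
      have hQ := M.trace_re_nonneg hpos
      replace h := (classicalQ_ofReal_of_lt_one hα0 hα1 hP hQ).symm.trans_lt h
      obtain ⟨u, v, huv, hlt⟩ := exists_weights_lt hα0 hα1 hP hQ
        (ENNReal.ofReal_lt_ofReal_iff'.mp h).1
      refine ⟨_, mem_weightedPairs M huv, ?_⟩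
      simpa only [M.trace_weighted_mul] using hlt
  exact ⟨_, _, ⟨y, hy, Z, hZ, rfl, rfl⟩, hle⟩

theorem exists_isRecoveryBound_of_lt_measuredRecoveryQ (hα : 1 < α)
    (hρ : IsDensityOperator ρ) (hσ : IsDensityOperator σ) {c : ℝ} (hc0 : 0 ≤ c)
    (hc : ENNReal.ofReal c < measuredRecoveryQ α ρ σ) :
    ∃ a b, IsRecoveryBound α ρ σ a b ∧ c ≤ α * a + (1 - α) * b := by
  classical
  have : Nonempty D := (nonempty_prod.mp hρ.nonempty).2
  have : Nonempty E := (nonempty_prod.mp hσ.nonempty).2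
  rw [measuredRecoveryQ, if_neg hα.not_gt] at hc
  -- The objective is negated, which makes the coefficient `α - 1` of the recovered state positive.
  obtain ⟨y, hy, Z, hZ, hle⟩ := exists_dual_operator ρ hσ.posSemidef
    (convex_weightedPairs α) (fun y hy => posSemidef_snd_of_mem_weightedPairs hy) (-α)
    (sub_pos.mpr hα) (c := -c) fun C hC hC1 => by
      have h := hc.trans_le (iInf_le _ (QuantumChannel.ofChoi C hC hC1))
      have hpos := (hσ.idTensor (QuantumChannel.ofChoi C hC hC1)).posSemidef
      change (link σ C).PosSemidef at hpos
      change _ < measuredQ α ρ (link σ C) at h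
      rw [measuredQ, if_neg hα.not_gt, lt_iSup_iff] at h
      obtain ⟨n, h⟩ := h
      rw [lt_iSup_iff] at h
      obtain ⟨M, h⟩ := h
      obtain ⟨u, v, huv, hlt⟩ := exists_weights_gt hα (M.trace_re_nonneg hρ.posSemidef)
        (M.trace_re_nonneg hpos) hc0 h
      refine ⟨_, mem_weightedPairs M huv, ?_⟩
      simp only [M.trace_weighted_mul]
      linarith
  exact ⟨_, _, ⟨y, hy, Z, hZ, rfl, rfl⟩, by linarith⟩

/-- Submultiplicativity of the optimal value for `α < 1`. -/
theorem measuredRecoveryQ_bipartiteTensor_le (hα0 : 0 < α) (hα1 : α < 1)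
    (hρ : IsDensityOperator ρ) (hτ : IsDensityOperator τ)
    (hσ : IsDensityOperator σ) (hω : IsDensityOperator ω) (hρσ : measuredRecoveryQ α ρ σ ≠ ⊤)
    (hτω : measuredRecoveryQ α τ ω ≠ ⊤) :
    measuredRecoveryQ α (bipartiteTensor ρ τ) (bipartiteTensor σ ω) ≤
      measuredRecoveryQ α ρ σ * measuredRecoveryQ α τ ω := by
  have : Nonempty D := (nonempty_prod.mp hρ.nonempty).2
  have : Nonempty D' := (nonempty_prod.mp hτ.nonempty).2
  -- Finiteness of both factors excludes the product `0 * ∞`, for which approximation from above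
  -- fails.
  refine ENNReal.le_mul_of_forall_lt (.inr hτω) (.inl hρσ) fun c hc c' hc' => ?_
  rcases eq_or_ne c ⊤ with rfl | hct
  · rw [ENNReal.top_mul hc'.ne_bot]
    exact le_top
  rcases eq_or_ne c' ⊤ with rfl | hct'
  · rw [ENNReal.mul_top hc.ne_bot]
    exact le_top
  rw [← ENNReal.ofReal_toReal hct] at hc ⊢
  rw [← ENNReal.ofReal_toReal hct'] at hc' ⊢
  obtain ⟨a, b, h, hab⟩ := exists_isRecoveryBound_of_measuredRecoveryQ_lt hα0 hα1 hρ hσ hc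
  obtain ⟨a', b', h', hab'⟩ := exists_isRecoveryBound_of_measuredRecoveryQ_lt hα0 hα1 hτ hω hc'
  have ha := h.left_pos hρ
  have ha' := h'.left_pos hτ
  have hb := h.nonneg hσ.posSemidef
  have hb' := h'.nonneg hω.posSemidef
  rw [measuredRecoveryQ, if_pos hα1]
  refine iSup_le fun Γ => ((h.bipartiteTensor h' hρ.posSemidef hσ.posSemidef
    hω.posSemidef).measuredQ_le hα0 hα1 (hρ.bipartiteTensor hτ) (hσ.bipartiteTensor hω) Γ).trans ?_
  rw [← ENNReal.ofReal_mul ENNReal.toReal_nonneg, Real.mul_rpow ha.le ha'.le,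
    Real.mul_rpow hb hb', mul_mul_mul_comm]
  have h1 := (IsWeightPair.one α).rpow_mul_rpow_le hα0 hα1 ha.le hb
  have h2 := (IsWeightPair.one α).rpow_mul_rpow_le hα0 hα1 ha'.le hb'
  simp only [mul_one] at h1 h2
  exact ENNReal.ofReal_le_ofReal (mul_le_mul (h1.trans hab) (h2.trans hab') (by positivity)
    ENNReal.toReal_nonneg)

/-- Supermultiplicativity of the optimal value for `1 < α`. -/
theorem le_measuredRecoveryQ_bipartiteTensor (hα : 1 < α)
    (hρ : IsDensityOperator ρ) (hτ : IsDensityOperator τ)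
    (hσ : IsDensityOperator σ) (hω : IsDensityOperator ω) :
    measuredRecoveryQ α ρ σ * measuredRecoveryQ α τ ω ≤
      measuredRecoveryQ α (bipartiteTensor ρ τ) (bipartiteTensor σ ω) := by
  classical
  have : Nonempty D := (nonempty_prod.mp hρ.nonempty).2
  have : Nonempty D' := (nonempty_prod.mp hτ.nonempty).2
  refine ENNReal.mul_le_of_forall_lt fun c hc c' hc' => ?_
  have hct := hc.ne_top
  have hct' := hc'.ne_top
  rw [← ENNReal.ofReal_toReal hct] at hc ⊢
  rw [← ENNReal.ofReal_toReal hct'] at hc' ⊢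
  obtain ⟨a, b, h, hab⟩ := exists_isRecoveryBound_of_lt_measuredRecoveryQ hα hρ hσ
    ENNReal.toReal_nonneg hc
  obtain ⟨a', b', h', hab'⟩ := exists_isRecoveryBound_of_lt_measuredRecoveryQ hα hτ hω
    ENNReal.toReal_nonneg hc'
  have ha := h.left_pos hρ
  have ha' := h'.left_pos hτ
  have hb := h.nonneg hσ.posSemidef
  have hb' := h'.nonneg hω.posSemidef
  have hprod := h.bipartiteTensor h' hρ.posSemidef hσ.posSemidef hω.posSemidef
  rw [measuredRecoveryQ, if_neg hα.not_gt]
  refine le_iInf fun Γ => le_trans ?_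
    (hprod.le_measuredQ hα (hρ.bipartiteTensor hτ) (hσ.bipartiteTensor hω) Γ)
  -- The given joint channel forces `b * b' > 0`, so neither factor vanishes and the support
  -- conditions below are vacuous.
  have hbb := hprod.right_pos (hσ.bipartiteTensor hω) Γ
  rw [← ENNReal.ofReal_mul ENNReal.toReal_nonneg, Real.mul_rpow ha.le ha'.le,
    Real.mul_rpow hb hb', mul_mul_mul_comm]
  have h1 := (IsWeightPair.one α).le_rpow_mul_rpow hα ha.le hb
    fun h => absurd h (left_ne_zero_of_mul hbb.ne')
  have h2 := (IsWeightPair.one α).le_rpow_mul_rpow hα ha'.le hb'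
    fun h => absurd h (right_ne_zero_of_mul hbb.ne')
  simp only [mul_one] at h1 h2
  exact ENNReal.ofReal_le_ofReal (mul_le_mul (hab.trans h1) (hab'.trans h2)
    ENNReal.toReal_nonneg (by positivity))

/-- The trivial one-outcome measurement has value `1` for every channel. -/
theorem measuredRecoveryQ_le_one (hα1 : α < 1) (hρ : IsDensityOperator ρ)
    (hσ : IsDensityOperator σ) : measuredRecoveryQ α ρ σ ≤ 1 := by
  rw [measuredRecoveryQ, if_pos hα1]
  refine iSup_le fun Γ => ?_
  rw [measuredQ, if_pos hα1]
  refine iInf₂_le_of_le 1 ⟨fun _ => 1, fun _ => PosSemidef.one, by simp⟩ ?_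
  simp [classicalQ, POVM.stat, hρ.trace_eq_one, (hσ.idTensor Γ).trace_eq_one]

end Recovery

/-- Equality can fail for `c < 0`: with opposite infinities, `⊤ + ⊥ = ⊥` makes the left side `⊥` and
the right side `⊤`. Only this direction is needed. -/
theorem EReal.coe_mul_add_coe_mul_le (c : ℝ) (x y : EReal) :
    (c : EReal) * x + (c : EReal) * y ≤ c * (x + y) := by
  rcases le_or_gt 0 c with hc | hc
  · rw [EReal.left_distrib_of_nonneg_of_ne_top (by exact_mod_cast hc) (EReal.coe_ne_top c)]
  · induction x <;> induction y
    case coe.coe x y =>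
      norm_cast
      rw [mul_add]
    all_goals simp [EReal.coe_mul_bot_of_neg hc, EReal.coe_mul_top_of_neg hc]

end

theorem proposition7 {A D E A' D' E' : Type*}
    [Fintype A] [DecidableEq A] [Fintype D] [DecidableEq D] [Fintype E]
    [Fintype A'] [DecidableEq A'] [Fintype D'] [DecidableEq D'] [Fintype E']
    (ρ : Matrix (A × D) (A × D) ℂ) (τ : Matrix (A' × D') (A' × D') ℂ)
    (σ : Matrix (A × E) (A × E) ℂ) (ω : Matrix (A' × E') (A' × E') ℂ)
    (hρ : IsDensityOperator ρ) (hτ : IsDensityOperator τ)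
    (hσ : IsDensityOperator σ) (hω : IsDensityOperator ω)
    (hσA : (marginal σ).PosDef) (hωA' : (marginal ω).PosDef)
    (α : ℝ) (hα : α ∈ Set.Ioo 0 1 ∪ Set.Ioi 1) :
    measuredRenyiRecovery α ρ σ + measuredRenyiRecovery α τ ω ≤
      measuredRenyiRecovery α (bipartiteTensor ρ τ) (bipartiteTensor σ ω) := by
  rw [measuredRenyiRecovery, measuredRenyiRecovery, measuredRenyiRecovery]
  refine (EReal.coe_mul_add_coe_mul_le _ _ _).trans ?_
  rw [← ENNReal.log_mul_add]
  rcases hα with ⟨hα0, hα1⟩ | hα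
  · simp only [mul_comm (((α - 1)⁻¹ : ℝ) : EReal)]
    refine EReal.mul_le_mul_of_nonpos_right (ENNReal.log_monotone ?_) ?_
    · exact measuredRecoveryQ_bipartiteTensor_le hα0 hα1 hρ hτ hσ hω
        (ne_top_of_le_ne_top ENNReal.one_ne_top (measuredRecoveryQ_le_one hα1 hρ hσ))
        (ne_top_of_le_ne_top ENNReal.one_ne_top (measuredRecoveryQ_le_one hα1 hτ hω))
    · exact_mod_cast inv_nonpos.mpr (sub_nonpos.mpr hα1.le)
  · gcongr
    · exact_mod_cast inv_nonneg.mpr (sub_nonneg.mpr (le_of_lt hα))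
    · exact le_measuredRecoveryQ_bipartiteTensor hα hρ hτ hσ hω
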